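/- Theorem 3.1. Let $n\ge 0$ be an integer and let $\Lambda_n(z)=\sum_{k=0}^n \lambda_k\binom nk z^k$ and $P_n(z)=\sum_{k=0}^n a_k z^k$ be arbitrary polynomials of degree at most $n$ with complex coefficients. Denote their Szegő composition by $$\Lambda P_n(z):=\sum_{k=0}^n \lambda_k a_k z^k .$$ For a polynomial $Q$ with complex coefficients, let $$M(Q):=\exp\left(\frac1{2\pi}\int_0^{2\pi}\log|Q(e^{i\theta})|\,d\theta\right),\qquad \|Q\|_0:=\exp\left(\frac1\pi\iint_{\mathbb D}\log|Q(z)|\,dA(z)\right)$$ be Mahler's measure and its areal analog, where $\mathbb D$ is the open unit disk, $dA$ is Lebesgue area measure, and $M(0)=\|0\|_0=0$. Then $$\|\Lambda P_n\|_0\le M(\Lambda_n)\,\|P_n\|_0 .$$ -/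

import Mathlib

open Polynomial

/-- The areal Mahler measure (Bergman `A⁰` norm) of a complex polynomial,
`‖P‖₀ = exp ((1/π) ∬_𝔻 log |P(z)| dA)`, where `𝔻` is the open unit disk and `dA` is Lebesgue area
measure on `ℂ`. For `P = 0` the integrand is `-∞` everywhere, so the value is `exp (-∞) = 0`.
For `P ≠ 0` the integrand has only logarithmic singularities, so it is integrable. -/
noncomputable def arealMahlerMeasure (P : ℂ[X]) : ℝ :=
  open Classical in
  if P = 0 then 0
  else Real.exp (Real.pi⁻¹ * ∫ z in Metric.ball (0 : ℂ) 1, Real.log ‖P.eval z‖)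

/-- The Szegő composition of two polynomials in the space of polynomials of degree at most `n`:
for `Λ(z) = ∑_{k ≤ n} λ_k (n choose k) z^k` and `P(z) = ∑_{k ≤ n} a_k z^k` it is
`∑_{k ≤ n} λ_k a_k z^k`. Here `λ_k` is the `k`-th coefficient of `Λ` divided by the (nonzero)
binomial coefficient `n choose k`. -/
noncomputable def szegoComposition (n : ℕ) (Λ P : ℂ[X]) : ℂ[X] :=
  ∑ k ∈ Finset.range (n + 1), C (Λ.coeff k / (n.choose k : ℂ) * P.coeff k) * X ^ k

/-!
On each circle `|z| = r` with `0 < r < 1` the theorem reduces to the de Bruijn–Springer inequality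
`M(ΛP) ≤ M(Λ) M(P)` (`mahlerMeasure_szegoComposition_le`): composing with `Λ` commutes with the
dilation `z ↦ r z`, and in polar coordinates `∬_𝔻 log |Q| = 2π ∫₀¹ r log M(Q(r ·)) dr`
(`integral_ball_log_norm_eval`), so integrating the logarithm of the circular inequality against the
probability measure `2 r dr` gives the areal one.

The de Bruijn–Springer inequality is a maximum principle combined with Szegő's theorem on zeros.
The composition is linear in each argument, hence affine in the coefficients of each linear factor
of `Λ`. Since `α ↦ log M(A + α B)` is subharmonic, it is bounded on the unit disc by its supremum on
the unit circle (`mahlerMeasure_add_le_of_norm_lt_one`); homogenizing, each factor `a z + b`, whose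
Mahler measure is `max |a| |b|`, may be replaced by some `z - ζ` with `|ζ| = 1`
(`mahlerMeasure_map_le_of_unimodular`). Doing this for `Λ` and then for `P` leaves the case where
both are monic of degree `n` with all zeros on the unit circle. There the composition is monic with
all zeros in the closed unit disc, so its Mahler measure is `1`
(`mahlerMeasure_szegoComposition_of_unimodular`).

The location of the zeros is Grace's theorem (`apolarPairing_ne_zero`), proved by induction on the
degree: peeling off a factor `z - ζ` of `Λ` turns the other argument into its polar derivative,
whose zeros stay in the open unit disc by Laguerre's theorem (`polarDerivative_eval_ne_zero`).
-/

/-! ### Apolarity and the zeros of Szegő compositions -/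

/-- The bilinear pairing `∑_{k ≤ n} Λ_k Q_k / (n choose k)` on polynomials of degree at most `n`;
it is the value at `1` of the Szegő composition. Coefficients of index above `n` are ignored. -/
noncomputable def apolarPairing (n : ℕ) (Λ Q : ℂ[X]) : ℂ :=
  ∑ k ∈ Finset.range (n + 1), Λ.coeff k / (n.choose k : ℂ) * Q.coeff k

/-- The polar derivative `(1 + ζ z) Q' - n ζ Q` of `Q`, regarded as a polynomial of degree `n`. Up to
the factor `-ζ` it is the classical one with pole `-1/ζ`; this form lets it be the adjoint of
multiplication by `X - ζ` for `apolarPairing`. -/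
noncomputable def polarDerivative (n : ℕ) (ζ : ℂ) (Q : ℂ[X]) : ℂ[X] :=
  derivative Q + C ζ * (X * derivative Q) - C (n * ζ) * Q

theorem coeff_polarDerivative (n : ℕ) (ζ : ℂ) (Q : ℂ[X]) (k : ℕ) :
    (polarDerivative n ζ Q).coeff k = (k + 1) * Q.coeff (k + 1) - (n - k) * ζ * Q.coeff k := by
  have hX : (X * derivative Q).coeff k = k * Q.coeff k := by
    cases k with
    | zero => simp
    | succ k => rw [coeff_X_mul, coeff_derivative]; push_cast; ring
  simp only [polarDerivative, coeff_sub, coeff_add, coeff_C_mul, hX, coeff_derivative]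
  ring

/-- Multiplication by `X - ζ` and the polar derivative are adjoint up to a scalar. -/
theorem apolarPairing_X_sub_C_mul (n : ℕ) (ζ : ℂ) (Λ Q : ℂ[X]) (hΛ : Λ.natDegree ≤ n) :
    (n + 1) * apolarPairing (n + 1) ((X - C ζ) * Λ) Q =
      apolarPairing n Λ (polarDerivative (n + 1 : ℕ) ζ Q) := by
  have h0 : Λ.coeff (n + 1) = 0 := coeff_eq_zero_of_natDegree_lt (by lia)
  have key : apolarPairing (n + 1) ((X - C ζ) * Λ) Q =
      ∑ k ∈ Finset.range (n + 1), (Λ.coeff k / ((n + 1).choose (k + 1) : ℂ) * Q.coeff (k + 1) -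
        ζ * Λ.coeff k / ((n + 1).choose k : ℂ) * Q.coeff k) := by
    simp only [apolarPairing, sub_mul, coeff_sub, coeff_C_mul, sub_div, Finset.sum_sub_distrib]
    congr 1
    · rw [Finset.sum_range_succ']
      simp [coeff_X_mul]
    · rw [Finset.sum_range_succ]
      simp [h0]
  rw [key, apolarPairing, Finset.mul_sum]
  refine Finset.sum_congr rfl fun k hk => ?_
  have hk : k ≤ n := by simpa [Nat.lt_succ_iff] using hk
  have h1 : ((n.choose k : ℕ) : ℂ) ≠ 0 := by exact_mod_cast (Nat.choose_pos hk).ne'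
  have h2 : (((n + 1).choose (k + 1) : ℕ) : ℂ) ≠ 0 := by
    exact_mod_cast (Nat.choose_pos (by lia)).ne'
  have h3 : (((n + 1).choose k : ℕ) : ℂ) ≠ 0 := by exact_mod_cast (Nat.choose_pos (by lia)).ne'
  have e1 : ((n : ℂ) + 1) * n.choose k = (n + 1).choose (k + 1) * (k + 1) := by
    exact_mod_cast Nat.add_one_mul_choose_eq n k
  have e2 : ((n : ℂ) + 1) * n.choose k = (n + 1).choose k * (n + 1 - k) := by
    have := Nat.choose_mul_succ_eq n k
    have h := congrArg (Nat.cast : ℕ → ℂ) this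
    rw [Nat.cast_mul, Nat.cast_mul, Nat.cast_sub (by lia)] at h
    push_cast at h
    linear_combination h
  rw [coeff_polarDerivative]
  have e1' : ((n : ℂ) + 1) / (n + 1).choose (k + 1) = (k + 1) / n.choose k := by
    rw [div_eq_div_iff h2 h1, e1]; ring
  have e2' : ((n : ℂ) + 1) / (n + 1).choose k = (n + 1 - k) / n.choose k := by
    rw [div_eq_div_iff h3 h1, e2]; ring
  push_cast
  linear_combination (Λ.coeff k * Q.coeff (k + 1)) * e1' - (ζ * Λ.coeff k * Q.coeff k) * e2'

theorem re_multiset_sum_map_pos {s : Multiset ℂ} (hs : s ≠ 0) {f : ℂ → ℂ}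
    (h : ∀ β ∈ s, 0 < (f β).re) : 0 < ((s.map f).sum).re := by
  have e : ((s.map f).sum).re = (s.map fun β => (f β).re).sum := by
    have := map_multiset_sum Complex.reCLM (s.map f)
    simpa [Multiset.map_map, Function.comp_def] using this
  rw [e]
  have := Multiset.sum_lt_sum_of_nonempty (f := fun _ => (0 : ℝ)) hs h
  simpa using this

theorem half_lt_re_inv_one_sub {w : ℂ} (hw : ‖w‖ < 1) : 1 / 2 < ((1 - w)⁻¹).re := by
  have hne : 1 - w ≠ 0 := by
    intro h
    have : w = 1 := by linear_combination -h
    simp [this] at hw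
  have hp : 0 < Complex.normSq (1 - w) := Complex.normSq_pos.2 hne
  have hw2 : Complex.normSq w < 1 := by
    rw [Complex.normSq_eq_norm_sq]; nlinarith [norm_nonneg w]
  rw [Complex.inv_re, lt_div_iff₀ hp]
  simp [Complex.normSq_apply] at *
  nlinarith

theorem re_inv_one_sub_le_half {w : ℂ} (hw : 1 ≤ ‖w‖) : ((1 - w)⁻¹).re ≤ 1 / 2 := by
  by_cases hne : 1 - w = 0
  · simp [hne]
  have hp : 0 < Complex.normSq (1 - w) := Complex.normSq_pos.2 hne
  have hw2 : 1 ≤ Complex.normSq w := by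
    rw [Complex.normSq_eq_norm_sq]; nlinarith [norm_nonneg w]
  rw [Complex.inv_re, div_le_iff₀ hp]
  simp [Complex.normSq_apply] at *
  nlinarith

/-- For `|ζ| = 1 ≤ |z|` the Möbius map `β ↦ (1 + ζ β) / (z - β)` sends the open unit disc into an open
half plane with `0` on its boundary, because its zero lies on the unit circle and its pole is not in
the open disc. -/
theorem exists_mul_re_pos {ζ z : ℂ} (hζ : ‖ζ‖ = 1) (hz : 1 ≤ ‖z‖) :
    ∃ u : ℂ, ∀ β : ℂ, ‖β‖ < 1 → 0 < (u * ((1 + ζ * β) / (z - β))).re := by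
  have hζ0 : ζ ≠ 0 := by rintro rfl; simp at hζ
  have hne : ∀ β : ℂ, ‖β‖ < 1 → z - β ≠ 0 ∧ 1 + ζ * β ≠ 0 := by
    refine fun β hβ => ⟨fun h => ?_, fun h => ?_⟩
    · rw [sub_eq_zero.1 h] at hz; linarith
    · have : ‖ζ * β‖ = 1 := by
        rw [show ζ * β = -1 by linear_combination h]; simp
      rw [norm_mul, hζ] at this; linarith
  by_cases h0 : 1 + ζ * z = 0
  · refine ⟨-ζ⁻¹, fun β hβ => ?_⟩
    obtain ⟨h1, h2⟩ := hne β hβ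
    have : -ζ⁻¹ * ((1 + ζ * β) / (z - β)) = 1 := by
      field_simp
      linear_combination -h0
    simp [this]
  · -- the reciprocal of each term is a difference of two values of `(1 - w)⁻¹`
    refine ⟨ζ⁻¹ * (1 + ζ * z), fun β hβ => ?_⟩
    obtain ⟨h1, h2⟩ := hne β hβ
    have e : (ζ⁻¹ * (1 + ζ * z) * ((1 + ζ * β) / (z - β)))⁻¹ =
        (1 - (-(ζ * β)))⁻¹ - (1 - (-(ζ * z)))⁻¹ := by
      have h2' : 1 - (-(ζ * β)) ≠ 0 := by simpa using h2
      have h0' : 1 - (-(ζ * z)) ≠ 0 := by simpa using h0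
      field_simp
      ring
    have hpos : 0 < ((ζ⁻¹ * (1 + ζ * z) * ((1 + ζ * β) / (z - β)))⁻¹).re := by
      rw [e, Complex.sub_re]
      have a := half_lt_re_inv_one_sub (w := -(ζ * β)) (by simpa [hζ] using hβ)
      have b := re_inv_one_sub_le_half (w := -(ζ * z)) (by simpa [hζ] using hz)
      linarith
    set v := ζ⁻¹ * (1 + ζ * z) * ((1 + ζ * β) / (z - β))
    have hv : v ≠ 0 := by rintro h; simp [h] at hpos
    rw [Complex.inv_re] at hpos
    exact (div_pos_iff_of_pos_right (Complex.normSq_pos.2 hv)).1 hpos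

/-- **Laguerre's theorem** for the unit disc: dividing by `Q z`, the polar derivative is the sum over
the zeros `β` of `Q` of the numbers `(1 + ζ β) / (z - β)`, all in one open half plane. -/
theorem polarDerivative_eval_ne_zero {n : ℕ} {ζ : ℂ} (hζ : ‖ζ‖ = 1) {Q : ℂ[X]}
    (hn : n ≠ 0) (hQ : Q.natDegree = n) (hr : ∀ β ∈ Q.roots, ‖β‖ < 1) {z : ℂ} (hz : 1 ≤ ‖z‖) :
    (polarDerivative n ζ Q).eval z ≠ 0 := by
  have hQ0 : Q ≠ 0 := by rintro rfl; simp at hQ; lia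
  have hz0 : Q.eval z ≠ 0 := fun h => by
    have := hr z ((mem_roots hQ0).2 h); linarith
  have hcard : Q.roots.card = n := by
    rw [← hQ]; exact (IsAlgClosed.splits Q).natDegree_eq_card_roots.symm
  have hder := (IsAlgClosed.splits Q).eval_derivative_div_eval_of_ne_zero hz0
  obtain ⟨u, hu⟩ := exists_mul_re_pos hζ hz
  have hpos := re_multiset_sum_map_pos (s := Q.roots)
    (by rintro h; rw [h] at hcard; simp at hcard; lia) (fun β hβ => hu β (hr β hβ))
  have hsum : (Q.roots.map fun β => u * ((1 + ζ * β) / (z - β))).sum =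
      u * ((1 + ζ * z) * (derivative Q).eval z / Q.eval z - n * ζ) := by
    rw [Multiset.sum_map_mul_left, mul_div_assoc, hder, ← hcard]
    congr 1
    have : ∀ β ∈ Q.roots, (1 + ζ * β) / (z - β) = (1 + ζ * z) * (1 / (z - β)) - ζ := by
      intro β hβ
      have : z - β ≠ 0 := fun h => by
        have h' := hr β hβ; rw [← sub_eq_zero.1 h] at h'; linarith
      field_simp
      ring
    rw [Multiset.map_congr rfl this, Multiset.sum_map_sub, Multiset.sum_map_mul_left]
    simp
  intro h
  have h' : (1 + ζ * z) * (derivative Q).eval z - n * ζ * Q.eval z = 0 := by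
    rw [← h]; simp [polarDerivative]; ring
  rw [hsum, mul_div_assoc] at hpos
  have : (1 + ζ * z) * ((derivative Q).eval z / Q.eval z) - n * ζ = 0 := by
    field_simp
    linear_combination h'
  simp [this] at hpos

/-- The degree drops by exactly one: the coefficient of index `n` is the leading coefficient of `Q`
times the sum of `1 + ζ β` over the zeros `β` of `Q`, and each summand has positive real part. -/
theorem natDegree_polarDerivative {n : ℕ} {ζ : ℂ} (hζ : ‖ζ‖ = 1) {Q : ℂ[X]}
    (hQ : Q.natDegree = n + 1) (hr : ∀ β ∈ Q.roots, ‖β‖ < 1) :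
    (polarDerivative (n + 1 : ℕ) ζ Q).natDegree = n := by
  have hQ0 : Q ≠ 0 := by rintro rfl; simp at hQ
  have hcard : Q.roots.card = n + 1 := by
    rw [← hQ]; exact (IsAlgClosed.splits Q).natDegree_eq_card_roots.symm
  refine natDegree_eq_of_le_of_coeff_ne_zero ?_ ?_
  · rw [natDegree_le_iff_coeff_eq_zero]
    intro k hk
    rw [coeff_polarDerivative, coeff_eq_zero_of_natDegree_lt (show Q.natDegree < k + 1 by lia)]
    rcases eq_or_lt_of_le (Nat.succ_le_of_lt hk) with h | h
    · simp [← h]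
    · rw [coeff_eq_zero_of_natDegree_lt (show Q.natDegree < k by lia)]; simp
  · have hnext := (IsAlgClosed.splits Q).nextCoeff_eq_neg_sum_roots_mul_leadingCoeff
    rw [nextCoeff_of_natDegree_pos (by lia), hQ] at hnext
    have hlc : Q.coeff (n + 1) = Q.leadingCoeff := by rw [← hQ]; rfl
    have hpos := re_multiset_sum_map_pos (s := Q.roots) (f := fun β => 1 + ζ * β)
      (by rintro h; rw [h] at hcard; simp at hcard) (fun β hβ => by
        have h1 := (abs_le.1 (Complex.abs_re_le_norm (ζ * β))).1
        have h2 := hr β hβ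
        rw [norm_mul, hζ, one_mul] at h1
        simp only [Complex.add_re, Complex.one_re]
        linarith)
    have hsum : (Q.roots.map fun β => 1 + ζ * β).sum = (n + 1) + ζ * Q.roots.sum := by
      rw [Multiset.sum_map_add, Multiset.sum_map_mul_left]
      simp [hcard, add_comm]
    have e : (polarDerivative (n + 1 : ℕ) ζ Q).coeff n =
        ((n + 1) + ζ * Q.roots.sum) * Q.leadingCoeff := by
      rw [coeff_polarDerivative, hlc]
      simp only [Nat.add_sub_cancel] at hnext
      rw [hnext]
      push_cast
      ring
    rw [e, ← hsum]
    refine mul_ne_zero (fun h => ?_) (leadingCoeff_ne_zero.2 hQ0)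
    simp [h] at hpos

/-- **Grace's theorem**: polynomials of degree `n`, one with its zeros on the unit circle and the other
with its zeros in the open unit disc, are not apolar. -/
theorem apolarPairing_ne_zero (n : ℕ) : ∀ Λ Q : ℂ[X], Λ.Monic → Λ.natDegree = n →
    (∀ ζ ∈ Λ.roots, ‖ζ‖ = 1) → Q.natDegree = n → Q ≠ 0 → (∀ β ∈ Q.roots, ‖β‖ < 1) →
    apolarPairing n Λ Q ≠ 0 := by
  induction n with
  | zero =>
    intro Λ Q hΛ hΛn _ hQn hQ0 _
    have h1 : Λ.coeff 0 = 1 := by rw [← hΛn]; exact hΛ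
    have h2 : Q.coeff 0 ≠ 0 := by rw [← hQn]; exact leadingCoeff_ne_zero.2 hQ0
    simp [apolarPairing, h1, h2]
  | succ n ih =>
    intro Λ Q hΛ hΛn hΛr hQn _ hQr
    obtain ⟨ζ, hζ⟩ := Complex.exists_root (f := Λ) (by
      rw [← natDegree_pos_iff_degree_pos]; lia)
    obtain ⟨Λ', rfl⟩ := dvd_iff_isRoot.2 hζ
    have hΛ' : Λ'.Monic := (monic_X_sub_C ζ).of_mul_monic_left hΛ
    have hdeg : Λ'.natDegree = n := by
      rw [(monic_X_sub_C ζ).natDegree_mul hΛ', natDegree_X_sub_C] at hΛn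
      lia
    have hζ1 : ‖ζ‖ = 1 := hΛr ζ ((mem_roots hΛ.ne_zero).2 hζ)
    have hrec := apolarPairing_X_sub_C_mul n ζ Λ' Q hdeg.le
    have hD : ∀ z : ℂ, 1 ≤ ‖z‖ → (polarDerivative (n + 1 : ℕ) ζ Q).eval z ≠ 0 :=
      fun z hz => polarDerivative_eval_ne_zero hζ1 (by lia) hQn hQr hz
    have hD0 : polarDerivative (n + 1 : ℕ) ζ Q ≠ 0 := fun h => hD 1 (by simp) (by simp [h])
    intro h
    rw [h, mul_zero] at hrec
    refine ih Λ' _ hΛ' hdeg (fun η hη => hΛr η ?_) (natDegree_polarDerivative hζ1 hQn hQr) hD0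
      (fun β hβ => ?_) hrec.symm
    · rw [roots_mul hΛ.ne_zero]; exact Multiset.mem_add.2 (Or.inr hη)
    · by_contra hc
      exact hD β (not_lt.1 hc) ((mem_roots hD0).1 hβ)

theorem coeff_szegoComposition (n : ℕ) (Λ P : ℂ[X]) (k : ℕ) :
    (szegoComposition n Λ P).coeff k =
      if k ≤ n then Λ.coeff k / (n.choose k : ℂ) * P.coeff k else 0 := by
  simp only [szegoComposition, finsetSum_coeff, coeff_C_mul, coeff_X_pow]
  simp

theorem eval_szegoComposition (n : ℕ) (Λ P : ℂ[X]) (z : ℂ) :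
    (szegoComposition n Λ P).eval z = apolarPairing n Λ (P.comp (C z * X)) := by
  simp only [szegoComposition, apolarPairing, eval_finsetSum, comp_C_mul_X_coeff, eval_mul, eval_C,
    eval_pow, eval_X, mul_assoc]

/-- By Grace's theorem the zeros of the composition lie in the closed unit disc: at `γ` with
`|γ| > 1`, its value is the pairing of `Λ` with `P(γ z)`, whose zeros lie in the open disc. -/
theorem mahlerMeasure_szegoComposition_of_unimodular {n : ℕ} {Λ P : ℂ[X]}
    (hΛ : Λ.Monic) (hΛn : Λ.natDegree = n) (hΛr : ∀ ζ ∈ Λ.roots, ‖ζ‖ = 1)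
    (hP : P.Monic) (hPn : P.natDegree = n) (hPr : ∀ ζ ∈ P.roots, ‖ζ‖ = 1) :
    (szegoComposition n Λ P).mahlerMeasure = 1 := by
  have hlead : (szegoComposition n Λ P).coeff n = 1 := by
    have h1 : Λ.coeff n = 1 := by rw [← hΛn]; exact hΛ
    have h2 : P.coeff n = 1 := by rw [← hPn]; exact hP
    simp [coeff_szegoComposition, h1, h2]
  have hdeg : (szegoComposition n Λ P).natDegree = n := by
    refine natDegree_eq_of_le_of_coeff_ne_zero ?_ (by simp [hlead])
    rw [natDegree_le_iff_coeff_eq_zero]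
    intro k hk
    simp [coeff_szegoComposition, hk]
  have h0 : szegoComposition n Λ P ≠ 0 := by rintro h; simp [h] at hlead
  have hroots : ∀ γ ∈ (szegoComposition n Λ P).roots, ‖γ‖ ≤ 1 := by
    intro γ hγ
    by_contra! hc
    have hγ0 : γ ≠ 0 := by rintro rfl; simp at hc; linarith
    have hev := (mem_roots h0).1 hγ
    rw [IsRoot, eval_szegoComposition] at hev
    have hd : (P.comp (C γ * X)).natDegree = n := by
      rw [natDegree_comp, natDegree_C_mul_X _ hγ0, hPn, mul_one]
    have hc0 : P.comp (C γ * X) ≠ 0 := by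
      intro h
      have := congrArg (fun q => coeff q n) h
      simp only [comp_C_mul_X_coeff, coeff_zero] at this
      rw [show P.coeff n = 1 by rw [← hPn]; exact hP] at this
      simp [hγ0] at this
    refine apolarPairing_ne_zero n Λ _ hΛ hΛn hΛr hd hc0 (fun β hβ => ?_) hev
    have hb := (mem_roots hc0).1 hβ
    rw [IsRoot, eval_comp] at hb
    have := hPr (γ * β) ((mem_roots hP.ne_zero).2 (by simpa using hb))
    rw [norm_mul] at this
    nlinarith [norm_nonneg β]
  rw [mahlerMeasure_eq_leadingCoeff_mul_prod_roots, leadingCoeff, hdeg, hlead,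
    Multiset.map_congr rfl (fun γ hγ => max_eq_left (hroots γ hγ))]
  simp

open MeasureTheory Set Real

/-! ### Subharmonicity of the logarithmic Mahler measure on pencils -/

/-- Includes the degenerate case `a = 0`. -/
theorem mahlerMeasure_linear (a b : ℂ) : (C a * X + C b).mahlerMeasure = max ‖a‖ ‖b‖ := by
  by_cases ha : a = 0
  · simp [ha]
  · exact mahlerMeasure_C_mul_X_add_C ha b

theorem ae_eval_circleMap_ne_zero {Q : ℂ[X]} (hQ : Q ≠ 0) :
    ∀ᵐ θ ∂volume.restrict (Ioc 0 (2 * π)), Q.eval (circleMap 0 1 θ) ≠ 0 := by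
  rw [ae_restrict_iff' measurableSet_Ioc, ae_iff]
  have hfin : {θ | ¬(θ ∈ Ioc 0 (2 * π) → Q.eval (circleMap 0 1 θ) ≠ 0)}.Finite := by
    refine Finite.of_finite_image (f := circleMap 0 1)
      ((Multiset.finite_toSet Q.roots).subset ?_) ?_
    · rintro _ ⟨θ, hθ, rfl⟩
      simp only [mem_ofPred_eq, Classical.not_imp, not_not] at hθ
      exact (mem_roots hQ).2 hθ.2
    · intro x hx y hy h
      simp only [mem_ofPred_eq, Classical.not_imp, not_not] at hx hy
      exact injOn_circleMap_of_abs_sub_le (a := 0) (b := 2 * π) one_ne_zero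
        (by simp [abs_of_pos pi_pos])
        (by rw [uIoc_of_le (by positivity)]; exact hx.1)
        (by rw [uIoc_of_le (by positivity)]; exact hy.1) h
  exact hfin.measure_zero _

theorem integral_log_norm_eval_circleMap (Q : ℂ[X]) :
    ∫ θ in Ioc 0 (2 * π), log ‖Q.eval (circleMap 0 1 θ)‖ = 2 * π * Q.logMahlerMeasure := by
  rw [logMahlerMeasure_def, circleAverage_def, intervalIntegral.integral_of_le (by positivity),
    smul_eq_mul]
  field_simp

theorem integrable_log_norm_eval_circleMap (Q : ℂ[X]) :
    IntegrableOn (fun θ => log ‖Q.eval (circleMap 0 1 θ)‖) (Ioc 0 (2 * π)) :=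
  (intervalIntegrable_iff_integrableOn_Ioc_of_le (by positivity)).1 Q.intervalIntegrable_mahlerMeasure

/-- Valid also for `c = d = 0`, where both sides vanish since `log 0 = 0`. -/
theorem integral_log_norm_linear (c d : ℂ) :
    ∫ φ in Ioc 0 (2 * π), log ‖c + circleMap 0 1 φ * d‖ = 2 * π * log (max ‖d‖ ‖c‖) := by
  rw [← mahlerMeasure_linear, ← logMahlerMeasure_eq_log_MahlerMeasure,
    ← integral_log_norm_eval_circleMap]
  simp only [eval_add, eval_mul, eval_C, eval_X, mul_comm d, add_comm c]

theorem integrable_log_norm_linear (c d : ℂ) :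
    IntegrableOn (fun φ => log ‖c + circleMap 0 1 φ * d‖) (Ioc 0 (2 * π)) := by
  have := integrable_log_norm_eval_circleMap (C d * X + C c)
  simpa only [eval_add, eval_mul, eval_C, eval_X, mul_comm d, add_comm _ c] using this

theorem exists_log_norm_le (A B : ℂ[X]) : ∃ K : ℝ, 0 ≤ K ∧ ∀ θ φ : ℝ,
    log ‖A.eval (circleMap 0 1 θ) + circleMap 0 1 φ * B.eval (circleMap 0 1 θ)‖ ≤ K := by
  obtain ⟨a, ha⟩ := (isCompact_sphere (0 : ℂ) 1).exists_bound_of_continuousOn A.continuous.continuousOn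
  obtain ⟨b, hb⟩ := (isCompact_sphere (0 : ℂ) 1).exists_bound_of_continuousOn B.continuous.continuousOn
  have hmem : ∀ θ, circleMap 0 1 θ ∈ Metric.sphere (0 : ℂ) 1 := fun θ => by simp
  have ha0 : 0 ≤ a := (norm_nonneg _).trans (ha _ (hmem 0))
  have hb0 : 0 ≤ b := (norm_nonneg _).trans (hb _ (hmem 0))
  refine ⟨a + b, by positivity, fun θ φ => ?_⟩
  refine (log_le_self (norm_nonneg _)).trans ((norm_add_le _ _).trans ?_)
  rw [norm_mul]
  simpa using add_le_add (ha _ (hmem θ)) (hb _ (hmem θ))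

/-- The integrand is bounded above, and its integral in the second variable is
`2π log max |A| |B|`, which is integrable in the first; so Tonelli's theorem applies. No
assumption on zeros is needed because `log 0 = 0`. -/
theorem integrable_prod_log_norm (A B : ℂ[X]) :
    Integrable (fun p : ℝ × ℝ => log ‖A.eval (circleMap 0 1 p.1) +
      circleMap 0 1 p.2 * B.eval (circleMap 0 1 p.1)‖)
      ((volume.restrict (Ioc 0 (2 * π))).prod (volume.restrict (Ioc 0 (2 * π)))) := by
  obtain ⟨K, hK0, hK⟩ := exists_log_norm_le A B
  have hmeas : Measurable (fun p : ℝ × ℝ => log ‖A.eval (circleMap 0 1 p.1) +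
      circleMap 0 1 p.2 * B.eval (circleMap 0 1 p.1)‖) := by
    refine measurable_log.comp (Continuous.measurable ?_)
    have h1 : Continuous fun p : ℝ × ℝ => circleMap 0 1 p.1 := by fun_prop
    have h2 : Continuous fun p : ℝ × ℝ => circleMap 0 1 p.2 := by fun_prop
    exact ((A.continuous.comp h1).add (h2.mul (B.continuous.comp h1))).norm
  rw [integrable_prod_iff hmeas.aestronglyMeasurable]
  refine ⟨.of_forall fun θ => integrable_log_norm_linear (A.eval (circleMap 0 1 θ))
    (B.eval (circleMap 0 1 θ)), ?_⟩
  have hbound : Integrable (fun θ => 2 * π * (2 * K) + 2 * π *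
      (|log ‖A.eval (circleMap 0 1 θ)‖| + |log ‖B.eval (circleMap 0 1 θ)‖|))
      (volume.restrict (Ioc 0 (2 * π))) :=
    (integrable_const _).add (((integrable_log_norm_eval_circleMap A).abs.add
      (integrable_log_norm_eval_circleMap B).abs).const_mul _)
  refine hbound.mono' hmeas.aestronglyMeasurable.norm.integral_prod_right' (.of_forall fun θ => ?_)
  rw [norm_of_nonneg (integral_nonneg fun _ => norm_nonneg _)]
  set a := A.eval (circleMap 0 1 θ)
  set b := B.eval (circleMap 0 1 θ)
  have h1 : ∫ φ in Ioc 0 (2 * π), ‖log ‖a + circleMap 0 1 φ * b‖‖ ≤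
      ∫ φ in Ioc 0 (2 * π), (2 * K - log ‖a + circleMap 0 1 φ * b‖) := by
    refine integral_mono (integrable_log_norm_linear a b).norm
      ((integrable_const _).sub (integrable_log_norm_linear a b)) fun φ => ?_
    have := hK θ φ
    simp only [Real.norm_eq_abs]
    exact abs_le.2 ⟨by linarith, by linarith⟩
  refine h1.trans ?_
  rw [integral_sub (integrable_const _) (integrable_log_norm_linear a b),
    integral_log_norm_linear, sub_eq_add_neg, ← mul_neg]
  have h2 : -log (max ‖b‖ ‖a‖) ≤ |log ‖a‖| + |log ‖b‖| := by
    rcases max_choice ‖b‖ ‖a‖ with h | h <;> rw [h]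
    · linarith [neg_le_abs (log ‖b‖), abs_nonneg (log ‖a‖)]
    · linarith [neg_le_abs (log ‖a‖), abs_nonneg (log ‖b‖)]
  have h3 : ∫ φ in Ioc 0 (2 * π), (2 * K) = 2 * π * (2 * K) := by
    simp [pi_pos.le]
  rw [h3]
  gcongr

theorem circleIntegrable_logMahlerMeasure_add (A B : ℂ[X]) :
    CircleIntegrable (fun ζ => (A + C ζ * B).logMahlerMeasure) 0 1 := by
  have h := (integrable_prod_log_norm A B).integral_prod_right
  rw [circleIntegrable_def, intervalIntegrable_iff_integrableOn_Ioc_of_le (by positivity)]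
  refine (h.const_mul (2 * π)⁻¹).congr (.of_forall fun φ => ?_)
  have := integral_log_norm_eval_circleMap (A + C (circleMap 0 1 φ) * B)
  simp only [eval_add, eval_mul, eval_C] at this
  simp only [this]
  field_simp

/-- The sub-mean value property of `ζ ↦ log M(A + ζ B)` at the origin: exchange the two circle
averages and use that the average of `log |a + ζ b|` over `ζ` is `log max |a| |b| ≥ log |a|`. -/
theorem logMahlerMeasure_le_circleAverage {A : ℂ[X]} (hA : A ≠ 0) (B : ℂ[X]) :
    A.logMahlerMeasure ≤ circleAverage (fun ζ => (A + C ζ * B).logMahlerMeasure) 0 1 := by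
  have hint := integrable_prod_log_norm A B
  have hswap := integral_integral_swap (f := fun θ φ : ℝ => log ‖A.eval (circleMap 0 1 θ) +
      circleMap 0 1 φ * B.eval (circleMap 0 1 θ)‖) hint
  simp only [integral_log_norm_linear] at hswap
  have hR : ∀ φ : ℝ, ∫ θ in Ioc 0 (2 * π), log ‖A.eval (circleMap 0 1 θ) +
      circleMap 0 1 φ * B.eval (circleMap 0 1 θ)‖ =
      2 * π * (A + C (circleMap 0 1 φ) * B).logMahlerMeasure := fun φ => by
    rw [← integral_log_norm_eval_circleMap]; simp
  simp only [hR, integral_const_mul] at hswap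
  have hswap' := mul_left_cancel₀ (by positivity) hswap
  rw [circleAverage_def, intervalIntegral.integral_of_le (by positivity), ← hswap', smul_eq_mul,
    le_inv_mul_iff₀ (by positivity), ← integral_log_norm_eval_circleMap]
  have hi : Integrable (fun θ => log (max ‖B.eval (circleMap 0 1 θ)‖ ‖A.eval (circleMap 0 1 θ)‖))
      (volume.restrict (Ioc 0 (2 * π))) := by
    refine (hint.integral_prod_left.const_mul (2 * π)⁻¹).congr (.of_forall fun θ => ?_)
    simp only [integral_log_norm_linear]
    field_simp
  refine integral_mono_ae (integrable_log_norm_eval_circleMap A) hi ?_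
  filter_upwards [ae_eval_circleMap_ne_zero hA] with θ hθ
  exact log_le_log (norm_pos_iff.2 hθ) (le_max_right _ _)

/-- The maximum principle for `α ↦ M(A + α B)` on the unit disc. -/
theorem mahlerMeasure_add_le_of_norm_lt_one {A B : ℂ[X]} {K : ℝ}
    (h : ∀ β : ℂ, ‖β‖ = 1 → (A + C β * B).mahlerMeasure ≤ K) {α : ℂ} (hα : ‖α‖ < 1) :
    (A + C α * B).mahlerMeasure ≤ K := by
  have hK : 0 ≤ K := (mahlerMeasure_nonneg _).trans (h 1 (by simp))
  by_cases h0 : A + C α * B = 0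
  · simpa [h0] using hK
  -- `log M` has its junk value `0` at the zero polynomial, so a pencil vanishing on the circle is
  -- treated apart
  by_cases hdeg : ∃ β : ℂ, ‖β‖ = 1 ∧ A + C β * B = 0
  · -- the pencil consists of the multiples of `B`, and `-β` maximizes the distance to `β`
    obtain ⟨β, hβ, hβ0⟩ := hdeg
    have hA : A = -(C β * B) := by linear_combination hβ0
    have h1 := h (-β) (by simpa using hβ)
    have e1 : A + C (-β) * B = C (-2 * β) * B := by
      rw [hA]; simp only [map_neg, map_mul]; rw [show (C 2 : ℂ[X]) = 2 from rfl]; ring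
    have e2 : A + C α * B = C (α - β) * B := by
      rw [hA, map_sub]; ring
    rw [e1, mahlerMeasure_mul, mahlerMeasure_const] at h1
    rw [e2, mahlerMeasure_mul, mahlerMeasure_const]
    refine le_trans (mul_le_mul_of_nonneg_right ?_ (mahlerMeasure_nonneg _)) h1
    refine (norm_sub_le _ _).trans ?_
    simp only [norm_mul, norm_neg, hβ, mul_one]
    norm_num
    linarith
  push Not at hdeg
  set D : ℂ[X] := C (starRingEnd ℂ α) * A + B with hD
  have hne : ∀ ζ : ℂ, ‖ζ‖ = 1 → 1 + starRingEnd ℂ α * ζ ≠ 0 := by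
    intro ζ hζ h
    have : ‖starRingEnd ℂ α * ζ‖ = 1 := by
      rw [show starRingEnd ℂ α * ζ = -1 by linear_combination h]; simp
    rw [norm_mul, hζ, RCLike.norm_conj] at this; linarith
  -- the disc automorphism `ζ ↦ (α + ζ) / (1 + conj α * ζ)` moves `α` to the centre
  have hstep : ∀ ζ : ℂ, ‖ζ‖ = 1 → (A + C α * B + C ζ * D).logMahlerMeasure ≤
      log ‖1 + starRingEnd ℂ α * ζ‖ + log K := by
    intro ζ hζ
    have hz := hne ζ hζ
    have hβ : ‖(α + ζ) / (1 + starRingEnd ℂ α * ζ)‖ = 1 := by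
      rw [norm_div, div_eq_one_iff_eq (norm_ne_zero_iff.2 hz)]
      have : α + ζ = ζ * starRingEnd ℂ (1 + starRingEnd ℂ α * ζ) := by
        have hzz : ζ * starRingEnd ℂ ζ = 1 := by
          rw [Complex.mul_conj, Complex.normSq_eq_norm_sq, hζ]; simp
        simp only [map_add, map_one, map_mul, Complex.conj_conj]
        linear_combination -α * hzz
      rw [this, norm_mul, hζ, one_mul, RCLike.norm_conj]
    have e : A + C α * B + C ζ * D = C (1 + starRingEnd ℂ α * ζ) *
        (A + C ((α + ζ) / (1 + starRingEnd ℂ α * ζ)) * B) := by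
      rw [mul_add (C (1 + starRingEnd ℂ α * ζ)), ← mul_assoc, ← C_mul, mul_div_cancel₀ _ hz, hD]
      simp only [map_add, map_mul, map_one]
      ring
    rw [e, logMahlerMeasure_C_mul hz (hdeg _ hβ), logMahlerMeasure_eq_log_MahlerMeasure]
    gcongr
    · exact mahlerMeasure_pos_of_ne_zero (hdeg _ hβ)
    · exact h _ hβ
  have hKpos : 0 < K := (mahlerMeasure_pos_of_ne_zero (hdeg 1 (by simp))).trans_le (h 1 (by simp))
  have havg : circleAverage (fun ζ => log ‖1 + starRingEnd ℂ α * ζ‖) 0 1 = 0 := by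
    have h1 := logMahlerMeasure_def (C (starRingEnd ℂ α) * X + C 1)
    rw [logMahlerMeasure_eq_log_MahlerMeasure, mahlerMeasure_linear, RCLike.norm_conj, norm_one,
      max_eq_right hα.le, log_one] at h1
    rw [h1]
    simp [add_comm]
  have hci : CircleIntegrable (fun ζ => log ‖1 + starRingEnd ℂ α * ζ‖) 0 1 := by
    rw [circleIntegrable_def]
    have := (C (starRingEnd ℂ α) * X + C 1).intervalIntegrable_mahlerMeasure
    simpa [add_comm] using this
  have hle := circleAverage_mono (circleIntegrable_logMahlerMeasure_add (A + C α * B) D)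
    (hci.add (circleIntegrable_const (log K) 0 1)) (fun ζ hζ => hstep ζ (by simpa using hζ))
  rw [circleAverage_add hci (circleIntegrable_const _ _ _), havg, circleAverage_const, zero_add] at hle
  have := (logMahlerMeasure_le_circleAverage h0 D).trans hle
  rw [logMahlerMeasure_eq_log_MahlerMeasure] at this
  exact (log_le_log_iff (mahlerMeasure_pos_of_ne_zero h0) hKpos).1 this

/-- Homogeneous form of the maximum principle, treating `A` and `B` symmetrically. -/
theorem mahlerMeasure_linear_comb_le {A B : ℂ[X]} {K : ℝ}
    (h : ∀ β : ℂ, ‖β‖ = 1 → (A + C β * B).mahlerMeasure ≤ K) (a b : ℂ) :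
    (C a * A + C b * B).mahlerMeasure ≤ max ‖a‖ ‖b‖ * K := by
  -- divide by the larger of the two coefficients
  have hle : ∀ {A B : ℂ[X]}, (∀ β : ℂ, ‖β‖ = 1 → (A + C β * B).mahlerMeasure ≤ K) →
      ∀ a b : ℂ, ‖b‖ ≤ ‖a‖ → (C a * A + C b * B).mahlerMeasure ≤ ‖a‖ * K := by
    intro A B h a b hba
    by_cases ha : a = 0
    · obtain rfl : b = 0 := by simpa [ha] using hba
      simp [ha]
    have e : C a * A + C b * B = C a * (A + C (b / a) * B) := by
      rw [mul_add, ← mul_assoc, ← C_mul, mul_div_cancel₀ _ ha]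
    rw [e, mahlerMeasure_mul, mahlerMeasure_const]
    gcongr
    have hn : ‖b / a‖ ≤ 1 := by
      rw [norm_div]; exact div_le_one_of_le₀ hba (norm_nonneg _)
    rcases hn.lt_or_eq with hlt | heq
    · exact mahlerMeasure_add_le_of_norm_lt_one h hlt
    · exact h _ heq
  rcases le_total ‖b‖ ‖a‖ with hba | hab
  · rw [max_eq_left hba]; exact hle h a b hba
  · rw [max_eq_right hab, add_comm]
    refine hle (fun β hβ => ?_) b a hab
    have hβ0 : β ≠ 0 := by rintro rfl; simp at hβ
    have e : B + C β * A = C β * (A + C β⁻¹ * B) := by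
      rw [mul_add, ← mul_assoc, ← C_mul, mul_inv_cancel₀ hβ0, C_1]; ring
    rw [e, mahlerMeasure_mul, mahlerMeasure_const, hβ, one_mul]
    exact h _ (by simp [hβ])

/-- The linear factor is constant when `Λ` has degree less than `n + 1`, which corresponds to a zero at
infinity. -/
theorem exists_eq_mul_linear {n : ℕ} {Λ : ℂ[X]} (hΛ : Λ.natDegree ≤ n + 1) :
    ∃ (Q : ℂ[X]) (a b : ℂ), Q.natDegree ≤ n ∧ Λ = Q * (C a * X + C b) := by
  by_cases h : Λ.natDegree ≤ n
  · exact ⟨Λ, 0, 1, h, by simp⟩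
  obtain ⟨ζ, hζ⟩ := Complex.exists_root (f := Λ) (by
    rw [← natDegree_pos_iff_degree_pos]; lia)
  obtain ⟨Q, rfl⟩ := dvd_iff_isRoot.2 hζ
  refine ⟨Q, 1, -ζ, ?_, by simp [sub_eq_add_neg, mul_comm]⟩
  have hQ : Q ≠ 0 := by rintro rfl; simp at h
  rw [natDegree_mul (X_sub_C_ne_zero ζ) hQ, natDegree_X_sub_C] at hΛ
  lia

/-- A bound for `M(T Q) / M(Q)` over polynomials `Q` of degree at most `n` need only be checked on monic
`Q` of degree `n` with all zeros on the unit circle, where `M(Q) = 1`. The induction absorbs a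
unimodular factor `X + β` into the linear map `T`. -/
theorem mahlerMeasure_map_le_of_unimodular (n : ℕ) : ∀ (T : ℂ[X] →ₗ[ℂ] ℂ[X]) (K : ℝ),
    (∀ Q : ℂ[X], Q.Monic → Q.natDegree = n → (∀ ζ ∈ Q.roots, ‖ζ‖ = 1) →
      (T Q).mahlerMeasure ≤ K) →
    ∀ Λ : ℂ[X], Λ.natDegree ≤ n → (T Λ).mahlerMeasure ≤ Λ.mahlerMeasure * K := by
  induction n with
  | zero =>
    intro T K h Λ hΛ
    obtain ⟨c, rfl⟩ : ∃ c, Λ = C c := ⟨_, eq_C_of_natDegree_le_zero hΛ⟩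
    have e : T (C c) = C c * T 1 := by
      rw [← smul_eq_C_mul, ← map_smul, smul_eq_C_mul, mul_one]
    rw [e, mahlerMeasure_mul, mahlerMeasure_const]
    gcongr
    exact h 1 monic_one (by simp) (by simp)
  | succ n ih =>
    intro T K h Λ hΛ
    obtain ⟨Q, a, b, hQ, rfl⟩ := exists_eq_mul_linear hΛ
    have e : T (Q * (C a * X + C b)) = C a * T (Q * X) + C b * T Q := by
      rw [← smul_eq_C_mul (p := T _), ← smul_eq_C_mul (p := T _), ← map_smul, ← map_smul,
        ← map_add, smul_eq_C_mul, smul_eq_C_mul]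
      congr 1
      ring
    rw [e, mahlerMeasure_mul, mahlerMeasure_linear, mul_comm Q.mahlerMeasure, mul_assoc]
    refine mahlerMeasure_linear_comb_le (fun β hβ => ?_) a b
    have e' : T (Q * X) + C β * T Q = (T ∘ₗ LinearMap.mulRight ℂ (X + C β)) Q := by
      rw [← smul_eq_C_mul, ← map_smul, ← map_add, smul_eq_C_mul]
      simp only [LinearMap.comp_apply, LinearMap.mulRight_apply]
      congr 1
      ring
    rw [e']
    refine ih _ K (fun R hR hRn hRr => h (R * (X + C β)) (hR.mul (monic_X_add_C β)) ?_ ?_) Q hQ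
    · rw [hR.natDegree_mul (monic_X_add_C β), hRn, natDegree_X_add_C]
    · intro ζ hζ
      rw [roots_mul (hR.mul (monic_X_add_C β)).ne_zero, Multiset.mem_add, roots_X_add_C,
        Multiset.mem_singleton] at hζ
      rcases hζ with hζ | rfl
      · exact hRr ζ hζ
      · simpa using hβ

/-! ### Polar coordinates -/

theorem integrableOn_log_norm_sub (α : ℂ) :
    IntegrableOn (fun z => log ‖z - α‖) (Metric.ball (0 : ℂ) 1) := by
  -- this ball is large enough to contain the translate by `-α` of the unit ball
  have h0 : IntegrableOn (fun z : ℂ => log ‖z‖) (Metric.ball (0 : ℂ) (1 + ‖α‖)) := by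
    rw [integrableOn_fun_norm_addHaar volume (f := log)]
    have hi : IntervalIntegrable (fun y : ℝ => y * log y) volume 0 (1 + ‖α‖) :=
      intervalIntegral.intervalIntegrable_log'.continuousOn_mul continuousOn_id
    rw [intervalIntegrable_iff_integrableOn_Ioo_of_le (by positivity)] at hi
    simpa [Complex.finrank_real_complex] using hi
  have h1 := (measurePreserving_sub_right volume α).integrableOn_comp_preimage
    (measurableEmbedding_subRight α) |>.2 h0
  refine h1.mono_set fun z hz => ?_
  simp only [Set.mem_preimage, mem_ball_zero_iff] at hz ⊢
  exact (norm_sub_le _ _).trans_lt (by linarith)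

theorem measurable_log_norm_eval (Q : ℂ[X]) : Measurable fun z : ℂ => log ‖Q.eval z‖ :=
  measurable_log.comp Q.continuous.norm.measurable

theorem integrableOn_log_norm_eval (Q : ℂ[X]) :
    IntegrableOn (fun z => log ‖Q.eval z‖) (Metric.ball (0 : ℂ) 1) := by
  have hmul : ∀ {P Q : ℂ[X]}, IntegrableOn (fun z => log ‖P.eval z‖) (Metric.ball (0 : ℂ) 1) →
      IntegrableOn (fun z => log ‖Q.eval z‖) (Metric.ball (0 : ℂ) 1) →
      IntegrableOn (fun z => log ‖(P * Q).eval z‖) (Metric.ball (0 : ℂ) 1) := by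
    intro P Q hP hQ
    refine (hP.abs.add hQ.abs).mono' (measurable_log_norm_eval _).aestronglyMeasurable
      (.of_forall fun z => ?_)
    simp only [eval_mul, norm_mul, Real.norm_eq_abs, Pi.add_apply]
    -- where a factor vanishes the left side is `|log 0| = 0`
    by_cases h1 : ‖P.eval z‖ = 0
    · simp [h1]
    by_cases h2 : ‖Q.eval z‖ = 0
    · simp [h2]
    rw [log_mul h1 h2]
    exact abs_add_le _ _
  rw [(IsAlgClosed.splits Q).eq_prod_roots]
  refine hmul (by simp) ?_
  induction Q.roots using Multiset.induction_on with
  | empty => simp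
  | cons α s ih =>
    rw [Multiset.map_cons, Multiset.prod_cons]
    exact hmul (by simpa using integrableOn_log_norm_sub α) ih

theorem integrableOn_polarCoord_symm {f : ℂ → ℝ} (hf : Integrable f) :
    IntegrableOn (fun p : ℝ × ℝ => p.1 * f (Complex.polarCoord.symm p)) polarCoord.target := by
  have h1 : Integrable (fun p : ℝ × ℝ => f (Complex.measurableEquivRealProd.symm p)) :=
    (Complex.volume_preserving_equiv_real_prod.symm).integrable_comp_of_integrable hf
  have h2 := (integrableOn_image_iff_integrableOn_abs_det_fderiv_smul volume
    polarCoord.open_target.measurableSet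
    (fun p _ => (hasFDerivAt_polarCoord_symm p).hasFDerivWithinAt)
    polarCoord.symm.injOn (fun p : ℝ × ℝ => f (Complex.measurableEquivRealProd.symm p))).1
    h1.integrableOn
  refine h2.congr_fun (fun p hp => ?_) polarCoord.open_target.measurableSet
  simp only [det_fderivPolarCoordSymm, abs_of_pos (show 0 < p.1 from hp.1), smul_eq_mul,
    Complex.measurableEquivRealProd_symm_polarCoord_symm_apply]

/-- Holds for every real `r`, as `polarCoord.symm (r, θ) = r e^{iθ}` also off the target of the chart. -/
theorem integral_log_norm_eval_polarCoord (Q : ℂ[X]) (r : ℝ) :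
    ∫ θ in Ioo (-π) π, log ‖Q.eval (Complex.polarCoord.symm (r, θ))‖ =
      2 * π * (Q.comp (C (r : ℂ) * X)).logMahlerMeasure := by
  rw [← integral_log_norm_eval_circleMap, ← integral_Ioc_eq_integral_Ioo,
    ← intervalIntegral.integral_of_le (by linarith [pi_pos]),
    ← intervalIntegral.integral_of_le (by positivity)]
  have hp : Function.Periodic
      (fun θ => log ‖(Q.comp (C (r : ℂ) * X)).eval (circleMap 0 1 θ)‖) (2 * π) := fun θ => by
    simp only [(periodic_circleMap 0 1) θ]
  have := hp.intervalIntegral_add_eq (-π) 0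
  rw [show -π + 2 * π = π by ring, zero_add] at this
  rw [← this]
  refine intervalIntegral.integral_congr fun θ _ => ?_
  simp [eval_comp, circleMap, Complex.exp_mul_I]

/-- The area integral of `log |Q|` over the unit disc in terms of the Mahler measures of the dilations
`z ↦ Q(r z)`, together with integrability in `r`. -/
theorem integral_ball_log_norm_eval (Q : ℂ[X]) :
    IntegrableOn (fun r : ℝ => r * (Q.comp (C (r : ℂ) * X)).logMahlerMeasure) (Ioo 0 1) ∧
    ∫ z in Metric.ball (0 : ℂ) 1, log ‖Q.eval z‖ =
      2 * π * ∫ r in Ioo (0 : ℝ) 1, r * (Q.comp (C (r : ℂ) * X)).logMahlerMeasure := by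
  set f : ℂ → ℝ := (Metric.ball (0 : ℂ) 1).indicator fun z => log ‖Q.eval z‖ with hf
  have hfi : Integrable f :=
    (integrable_indicator_iff measurableSet_ball).2 (integrableOn_log_norm_eval Q)
  have hpi := integrableOn_polarCoord_symm hfi
  have hsub : Ioo (0 : ℝ) 1 ×ˢ Ioo (-π) π ⊆ polarCoord.target :=
    prod_mono (fun r hr => hr.1) Subset.rfl
  have hval : ∀ p ∈ Ioo (0 : ℝ) 1 ×ˢ Ioo (-π) π, p.1 * f (Complex.polarCoord.symm p) =
      p.1 * log ‖Q.eval (Complex.polarCoord.symm p)‖ := by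
    rintro ⟨r, θ⟩ ⟨hr, -⟩
    rw [hf, indicator_of_mem]
    rw [mem_ball_zero_iff, Complex.norm_polarCoord_symm, abs_of_pos hr.1]
    exact hr.2
  have hmeas : MeasurableSet (Ioo (0 : ℝ) 1 ×ˢ Ioo (-π) π) := measurableSet_Ioo.prod measurableSet_Ioo
  have hint : IntegrableOn (fun p : ℝ × ℝ => p.1 * log ‖Q.eval (Complex.polarCoord.symm p)‖)
      (Ioo (0 : ℝ) 1 ×ˢ Ioo (-π) π) := (hpi.mono_set hsub).congr_fun hval hmeas
  have hinner : ∀ r : ℝ, ∫ θ in Ioo (-π) π, r * log ‖Q.eval (Complex.polarCoord.symm (r, θ))‖ =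
      2 * π * (r * (Q.comp (C (r : ℂ) * X)).logMahlerMeasure) := fun r => by
    rw [integral_const_mul, integral_log_norm_eval_polarCoord]; ring
  have hvol : (volume : Measure (ℝ × ℝ)) = (volume : Measure ℝ).prod volume := rfl
  constructor
  · have h := hint
    rw [IntegrableOn, hvol, ← Measure.prod_restrict] at h
    have h' := h.integral_prod_left
    simp only [hinner] at h'
    refine (h'.const_mul (2 * π)⁻¹).congr (.of_forall fun r => ?_)
    simp only
    field_simp
  · rw [← integral_indicator measurableSet_ball, ← hf, ← Complex.integral_comp_polarCoord_symm,
      ← integral_const_mul]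
    simp only [← hinner, smul_eq_mul]
    rw [← setIntegral_prod _ hint, ← setIntegral_congr_fun hmeas hval]
    refine setIntegral_eq_of_subset_of_forall_sdiff_eq_zero polarCoord.open_target.measurableSet
      hsub fun p hp => ?_
    rw [hf, indicator_of_notMem, mul_zero]
    rw [mem_ball_zero_iff, Complex.norm_polarCoord_symm]
    intro hlt
    have hp1 : 0 < p.1 := hp.1.1
    rw [abs_of_pos hp1] at hlt
    exact hp.2 ⟨⟨hp1, hlt⟩, hp.1.2⟩

/-! ### The de Bruijn–Springer inequality and its areal form -/

theorem szegoComposition_comm (n : ℕ) (Λ P : ℂ[X]) :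
    szegoComposition n Λ P = szegoComposition n P Λ := by
  simp only [szegoComposition, div_mul_comm]

/-- Szegő composition with a fixed polynomial `P`, as a linear map. -/
noncomputable def szegoCompositionLinear (n : ℕ) (P : ℂ[X]) : ℂ[X] →ₗ[ℂ] ℂ[X] where
  toFun Λ := szegoComposition n Λ P
  map_add' Λ Λ' := by
    ext k
    simp only [coeff_add, coeff_szegoComposition]
    split_ifs <;> ring
  map_smul' c Λ := by
    ext k
    simp only [coeff_smul, coeff_szegoComposition, smul_eq_mul, RingHom.id_apply]
    split_ifs <;> ring

/-- **De Bruijn–Springer inequality.** -/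
theorem mahlerMeasure_szegoComposition_le {n : ℕ} {Λ P : ℂ[X]} (hΛ : Λ.natDegree ≤ n)
    (hP : P.natDegree ≤ n) :
    (szegoComposition n Λ P).mahlerMeasure ≤ Λ.mahlerMeasure * P.mahlerMeasure := by
  refine mahlerMeasure_map_le_of_unimodular n (szegoCompositionLinear n P) _
    (fun Q hQ hQn hQr => ?_) Λ hΛ
  change (szegoComposition n Q P).mahlerMeasure ≤ _
  rw [szegoComposition_comm, ← mul_one P.mahlerMeasure]
  exact mahlerMeasure_map_le_of_unimodular n (szegoCompositionLinear n Q) 1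
    (fun R hR hRn hRr => (mahlerMeasure_szegoComposition_of_unimodular hR hRn hRr hQ hQn hQr).le) P hP

theorem szegoComposition_comp_C_mul_X (n : ℕ) (Λ P : ℂ[X]) (r : ℂ) :
    (szegoComposition n Λ P).comp (C r * X) = szegoComposition n Λ (P.comp (C r * X)) := by
  ext k
  simp only [comp_C_mul_X_coeff, coeff_szegoComposition]
  split_ifs <;> ring

theorem comp_C_mul_X_ne_zero {Q : ℂ[X]} (hQ : Q ≠ 0) {r : ℂ} (hr : r ≠ 0) :
    Q.comp (C r * X) ≠ 0 := by
  intro h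
  apply hQ
  ext k
  have := congrArg (fun q => coeff q k) h
  simpa [comp_C_mul_X_coeff, hr] using this

theorem arealMahlerMeasure_nonneg (P : ℂ[X]) : 0 ≤ arealMahlerMeasure P := by
  unfold arealMahlerMeasure
  split_ifs
  · exact le_rfl
  · exact (exp_pos _).le

theorem theorem3p1 (n : ℕ) (Λ P : Polynomial ℂ) (hΛ : Λ.natDegree ≤ n) (hP : P.natDegree ≤ n) :
    arealMahlerMeasure (szegoComposition n Λ P) ≤ Λ.mahlerMeasure * arealMahlerMeasure P := by
  by_cases h0 : szegoComposition n Λ P = 0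
  · rw [h0, arealMahlerMeasure, if_pos rfl]
    exact mul_nonneg (mahlerMeasure_nonneg _) (arealMahlerMeasure_nonneg _)
  have hΛ0 : Λ ≠ 0 := by rintro rfl; exact h0 (by simp [szegoComposition])
  have hP0 : P ≠ 0 := by rintro rfl; exact h0 (by simp [szegoComposition])
  obtain ⟨hi1, e1⟩ := integral_ball_log_norm_eval (szegoComposition n Λ P)
  obtain ⟨hi2, e2⟩ := integral_ball_log_norm_eval P
  have hcirc : ∀ r ∈ Ioo (0 : ℝ) 1,
      r * ((szegoComposition n Λ P).comp (C (r : ℂ) * X)).logMahlerMeasure ≤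
        r * log Λ.mahlerMeasure + r * (P.comp (C (r : ℂ) * X)).logMahlerMeasure := by
    intro r hr
    have hr0 : (r : ℂ) ≠ 0 := by exact_mod_cast hr.1.ne'
    rw [← mul_add]
    refine mul_le_mul_of_nonneg_left ?_ hr.1.le
    have hPr : (P.comp (C (r : ℂ) * X)).natDegree ≤ n := by
      rw [natDegree_comp, natDegree_C_mul_X _ hr0, mul_one]; exact hP
    have hpos := mahlerMeasure_pos_of_ne_zero (comp_C_mul_X_ne_zero h0 hr0)
    rw [logMahlerMeasure_eq_log_MahlerMeasure, logMahlerMeasure_eq_log_MahlerMeasure,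
      ← log_mul (mahlerMeasure_pos_of_ne_zero hΛ0).ne'
        (mahlerMeasure_pos_of_ne_zero (comp_C_mul_X_ne_zero hP0 hr0)).ne']
    refine log_le_log hpos ?_
    rw [szegoComposition_comp_C_mul_X]
    exact mahlerMeasure_szegoComposition_le hΛ hPr
  have hconst : IntegrableOn (fun r : ℝ => r * log Λ.mahlerMeasure) (Ioo 0 1) :=
    ((continuous_id.mul continuous_const).integrableOn_Icc).mono_set Ioo_subset_Icc_self
  have hmono := setIntegral_mono_on hi1 (hconst.add hi2) measurableSet_Ioo hcirc
  have hhalf : ∫ r in Ioo (0 : ℝ) 1, r * log Λ.mahlerMeasure = log Λ.mahlerMeasure / 2 := by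
    rw [integral_mul_const, ← integral_Ioc_eq_integral_Ioo,
      ← intervalIntegral.integral_of_le zero_le_one, integral_id]
    ring
  simp only [Pi.add_apply] at hmono
  rw [integral_add hconst hi2, hhalf] at hmono
  rw [arealMahlerMeasure, if_neg h0, arealMahlerMeasure, if_neg hP0, e1, e2,
    ← exp_log (mahlerMeasure_pos_of_ne_zero hΛ0), ← exp_add]
  refine exp_le_exp.2 ?_
  have hcancel : ∀ x : ℝ, π⁻¹ * (2 * π * x) = 2 * x := fun x => by field_simp
  rw [hcancel, hcancel]
  linarith
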